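/- For a real-analytic submanifold $M\subset\mathbb C^m$, let $T^{0,1}_pM$ be the space of vectors in $\mathbb C\otimes T_pM$ that lie in the span of $\partial/\partial\bar z_1,\dots,\partial/\partial\bar z_m$. A point $q\in M$ is a CR point if $\dim T^{0,1}_pM$ is constant for $p\in M$ near $q$, and a CR singularity otherwise; $M_{CR}$ is the set of CR points. The point $q$ is a removable CR singularity if, locally near $q$, there is a real-analytic complex vector bundle $\mathcal V\subset\mathbb C\otimes TM$ on $M$ with $\mathcal V_p=T^{0,1}_pM$ for every CR point $p$. **Proposition.** Let $M\subset\mathbb C^3$ be a connected real-analytic submanifold of real codimension $2$ such that $M_{CR}$ has CR dimension $1$, that is, $\dim_{\mathbb C}T^{0,1}_pM=1$ for all $p\in M_{CR}$. Suppose that $0\in M$ is a CR singularity of $M$ and that near $0$, in coordinates $(z,w)\in\mathbb C^2\times\mathbb C$, $M$ is given by $$w=Q(z,\bar z)+E(z,\bar z),$$ where $Q$ is a homogeneous quadratic polynomial in $(z,\bar z)$ with complex coefficients and $E$ is real-analytic near $0$ with $E=O(\|z\|^3)$. Suppose moreover that 1. $\bar\partial Q\not\equiv0$; 2. $Q$ does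 not correspond to a parabolic Bishop surface, that is, there are no $c\in\mathbb C\setminus\{0\}$ and invertible complex linear map $T\colon\mathbb C^2\to\mathbb C^2$ with $\bar\partial Q=c\,T^*\big((\zeta_1+\bar\zeta_1)\,d\bar\zeta_1\big)$; 3. the set of CR singularities of $M$ has, near $0$, real dimension less than $2$ (as a real-analytic variety). Then $0$ is not a removable CR singularity of $M$. -/

import Mathlib

open Filter Topology Asymptotics

noncomputable section

/-- `S ⊆ ℂᵐ` is, near its point `p`, an embedded real-analytic submanifold of real codimension `k`:
it is the zero set near `p` of `k` real-valued real-analytic functions whose differentials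
at `p` are linearly independent. -/
def IsAnalyticSubmanifoldAt {m : ℕ} (S : Set (Fin m → ℂ)) (k : ℕ) (p : Fin m → ℂ) : Prop :=
  p ∈ S ∧ ∃ f : (Fin m → ℂ) → (Fin k → ℝ), AnalyticAt ℝ f p ∧
    Function.Surjective (fderiv ℝ f p) ∧ ∀ᶠ x in 𝓝 p, (x ∈ S ↔ f x = 0)

/-- An (embedded) real-analytic submanifold of `ℂᵐ` of real codimension `k`. -/
def IsAnalyticSubmanifold {m : ℕ} (S : Set (Fin m → ℂ)) (k : ℕ) : Prop :=
  ∀ p ∈ S, IsAnalyticSubmanifoldAt S k p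

/-- The real dimension at `q` of a real-analytic subvariety `X`: for small neighborhoods `U` of `q`,
the largest dimension of `X` at a regular point in `U`, that is, a point near which `X` is
a real-analytic submanifold. It is `⊥` if `X` is empty near `q`. -/
def varietyDimAt {m : ℕ} (X : Set (Fin m → ℂ)) (q : Fin m → ℂ) : WithBot ℕ∞ :=
  ⨅ U ∈ 𝓝 q, sSup {e : WithBot ℕ∞ | ∃ p ∈ U, ∃ d k : ℕ,
    d + k = 2 * m ∧ IsAnalyticSubmanifoldAt X k p ∧ e = ((d : ℕ∞) : WithBot ℕ∞)}

/-- The real tangent space `T_p M`, spanned by the velocities at `p` of curves in `M`. -/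
def realTangentSpace {m : ℕ} (M : Set (Fin m → ℂ)) (p : Fin m → ℂ) :
    Submodule ℝ (Fin m → ℂ) :=
  Submodule.span ℝ {v | ∃ γ : ℝ → (Fin m → ℂ), γ 0 = p ∧ HasDerivAt γ v 0 ∧
    ∀ᶠ t in 𝓝 (0 : ℝ), γ t ∈ M}

/-- The complexified tangent space `ℂ ⊗ T_p M`. A complex tangent vector
`∑ aⱼ ∂/∂zⱼ + ∑ bⱼ ∂/∂z̄ⱼ` of `ℂᵐ` is written as the pair `(a, b)`; in this notation a real tangent
vector `v ∈ ℂᵐ` is `(v, v̄)`. -/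
def complexTangentSpace {m : ℕ} (M : Set (Fin m → ℂ)) (p : Fin m → ℂ) :
    Submodule ℂ ((Fin m → ℂ) × (Fin m → ℂ)) :=
  Submodule.span ℂ ((fun v : Fin m → ℂ => (v, star v)) '' (realTangentSpace M p : Set (Fin m → ℂ)))

/-- `T^{0,1}_p M`: the vectors of `ℂ ⊗ T_p M` in the span of `∂/∂z̄₁, …, ∂/∂z̄ₘ`. -/
def T01 {m : ℕ} (M : Set (Fin m → ℂ)) (p : Fin m → ℂ) :
    Submodule ℂ ((Fin m → ℂ) × (Fin m → ℂ)) :=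
  complexTangentSpace M p ⊓ LinearMap.ker (LinearMap.fst ℂ (Fin m → ℂ) (Fin m → ℂ))

/-- `q ∈ M` is a CR point: `dim T^{0,1}_p M` is constant for `p ∈ M` near `q`. -/
def IsCRPoint {m : ℕ} (M : Set (Fin m → ℂ)) (q : Fin m → ℂ) : Prop :=
  q ∈ M ∧ ∀ᶠ p in 𝓝[M] q, Module.finrank ℂ (T01 M p) = Module.finrank ℂ (T01 M q)

/-- The set of CR singularities of `M`. -/
def crSingularSet {m : ℕ} (M : Set (Fin m → ℂ)) : Set (Fin m → ℂ) :=
  {q | q ∈ M ∧ ¬ IsCRPoint M q}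

/-- The subspaces `V p` with `p ∈ M ∩ U` form a real-analytic complex vector subbundle of
`ℂ ⊗ TM` over `M ∩ U`: near each point there is a frame consisting of (restrictions to `M` of)
real-analytic maps. -/
def IsAnalyticSubbundle {m : ℕ} (M U : Set (Fin m → ℂ))
    (V : (Fin m → ℂ) → Submodule ℂ ((Fin m → ℂ) × (Fin m → ℂ))) : Prop :=
  ∀ p ∈ M ∩ U, V p ≤ complexTangentSpace M p ∧
    ∃ (r : ℕ) (s : Fin r → (Fin m → ℂ) → (Fin m → ℂ) × (Fin m → ℂ)),
      (∀ i, AnalyticAt ℝ (s i) p) ∧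
      ∀ᶠ x in 𝓝[M] p, LinearIndependent ℂ (fun i => s i x) ∧
        Submodule.span ℂ (Set.range fun i => s i x) = V x

/-- `q ∈ M` is a removable CR singularity (CR points are allowed): near `q` there is
a real-analytic vector bundle on `M` whose fiber at every CR point `p` is `T^{0,1}_p M`. -/
def IsRemovableCRSingularity {m : ℕ} (M : Set (Fin m → ℂ)) (q : Fin m → ℂ) : Prop :=
  q ∈ M ∧ ∃ (U : Set (Fin m → ℂ)) (V : (Fin m → ℂ) → Submodule ℂ ((Fin m → ℂ) × (Fin m → ℂ))),
    IsOpen U ∧ q ∈ U ∧ IsAnalyticSubbundle M U V ∧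
      ∀ p ∈ U, IsCRPoint M p → V p = T01 M p

/-- `Q` is a quadratic form in `(z, z̄)`, `z ∈ ℂⁿ`, with complex coefficients. -/
def IsQuadraticInZZbar {n : ℕ} (Q : (Fin n → ℂ) → ℂ) : Prop :=
  ∃ A B C : Matrix (Fin n) (Fin n) ℂ, ∀ z, Q z = ∑ j, ∑ k,
    (A j k * z j * z k + B j k * z j * star (z k) + C j k * star (z j) * star (z k))

/-- The value of the `(0,1)`-form `∂̄f = ∑ (∂f/∂z̄ⱼ) dz̄ⱼ` at the point `z` on the tangent
vector `v`, that is, the conjugate-linear part of the real differential of `f`. -/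
def dbar {n : ℕ} (f : (Fin n → ℂ) → ℂ) (z v : Fin n → ℂ) : ℂ :=
  (fderiv ℝ f z v + Complex.I * fderiv ℝ f z (Complex.I • v)) / 2

/-- The form `(ζ₁ + ζ̄₁) dζ̄₁` on `ℂ²`, at the point `ζ` on the tangent vector `v`. -/
def parabolicForm (ζ v : Fin 2 → ℂ) : ℂ :=
  (ζ 0 + star (ζ 0)) * star (v 0)

/-- `Q` corresponds to a parabolic Bishop surface: up to a nonzero constant factor (a rescaling
of the coordinate `w` in `w = Q`), `∂̄Q` is the pullback of `(ζ₁ + ζ̄₁) dζ̄₁` under an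
invertible complex linear map. -/
def CorrespondsToParabolicBishop (Q : (Fin 2 → ℂ) → ℂ) : Prop :=
  ∃ (c : ℂ) (T : (Fin 2 → ℂ) ≃ₗ[ℂ] (Fin 2 → ℂ)), c ≠ 0 ∧
    ∀ z v, dbar Q z v = c * parabolicForm (T z) (T v)

end

/-! On a graph `w = ρ(z)`, a vector of `T^{0,1}` is determined by its coefficients `(a₀, a₁)` along
`∂/∂z̄₀, ∂/∂z̄₁`, and the only condition on them is `a₀f + a₁g = 0`, where `f, g` are the two
coefficients of `∂̄ρ` (`mem_T01_iff`). Hence near `0` the CR singularities are the common zeros of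
`f` and `g`: two complex equations.

If `0` were removable, a frame section of the bundle would give real-analytic `b, c`, not both zero
at `0`, with `bf + cg = 0` (`exists_relation_of_isRemovable`). The two equations then collapse to
the single one `G = 0`, where `G` is the combination of `f, g` along the vector conjugate-orthogonal
to `(b(0), c(0))`. Differentiating the relation at `0` gives the same relation, with constant
coefficients, for `∂̄Q`. The symmetry of the `z̄z̄` part of `Q` then leaves two possibilities
(`surjective_linForm_of_relation`): `dG(0)` is onto `ℂ`, or `∂̄Q = (aζ + eζ̄) dζ̄` for one linear
form `ζ` with `|a| = |e|`, which is zero or parabolic. So `dG(0)` is onto, and the CR singular set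
is a real surface near `0`, against the bound on its dimension. -/

/-- The projection `(z, w) ↦ z` of `ℂ² × ℂ`. -/
noncomputable def projZ : (Fin 3 → ℂ) →L[ℝ] (Fin 2 → ℂ) :=
  ContinuousLinearMap.pi fun i => ContinuousLinearMap.proj (i.castSucc : Fin 3)

theorem projZ_apply (p : Fin 3 → ℂ) : projZ p = ![p 0, p 1] := by
  ext i
  fin_cases i <;> rfl

theorem projZ_smul (c : ℂ) (p : Fin 3 → ℂ) : projZ (c • p) = c • projZ p := by
  ext i
  fin_cases i <;> rfl

/-- The point `(z, w)` of `ℂ² × ℂ`. -/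
def graphPoint (z : Fin 2 → ℂ) (w : ℂ) : Fin 3 → ℂ := ![z 0, z 1, w]

theorem projZ_graphPoint (z : Fin 2 → ℂ) (w : ℂ) : projZ (graphPoint z w) = z := by
  ext i
  fin_cases i <;> rfl

theorem graphPoint_projZ (p : Fin 3 → ℂ) : graphPoint (projZ p) (p 2) = p := by
  ext i
  fin_cases i <;> rfl

@[simp] theorem graphPoint_two (z : Fin 2 → ℂ) (w : ℂ) : graphPoint z w 2 = w := rfl

/-! ### Complex-linear and conjugate-linear parts of a real-linear functional -/

/-- The conjugate-linear part of a real-linear functional. -/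
noncomputable def conjPart (D : (Fin 2 → ℂ) →L[ℝ] ℂ) (v : Fin 2 → ℂ) : ℂ :=
  (D v + Complex.I * D (Complex.I • v)) / 2

/-- The complex-linear part of a real-linear functional. -/
noncomputable def linPart (D : (Fin 2 → ℂ) →L[ℝ] ℂ) (v : Fin 2 → ℂ) : ℂ :=
  (D v - Complex.I * D (Complex.I • v)) / 2

theorem real_linear_smul (D : (Fin 2 → ℂ) →L[ℝ] ℂ) (c : ℂ) (v : Fin 2 → ℂ) :
    D (c • v) = c.re * D v + c.im * D (Complex.I • v) := by
  have h : c • v = c.re • v + c.im • (Complex.I • v) := by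
    ext i
    simp only [Pi.smul_apply, Pi.add_apply, smul_eq_mul, Complex.real_smul]
    nth_rewrite 1 [← Complex.re_add_im c]
    ring
  rw [h, map_add, map_smul, map_smul, Complex.real_smul, Complex.real_smul]

theorem real_linear_I_I (D : (Fin 2 → ℂ) →L[ℝ] ℂ) (v : Fin 2 → ℂ) :
    D (Complex.I • Complex.I • v) = - D v := by
  rw [smul_smul, Complex.I_mul_I, neg_one_smul, map_neg]

theorem conjPart_add (D : (Fin 2 → ℂ) →L[ℝ] ℂ) (v w : Fin 2 → ℂ) :
    conjPart D (v + w) = conjPart D v + conjPart D w := by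
  simp only [conjPart, smul_add, map_add]
  ring

theorem linPart_add (D : (Fin 2 → ℂ) →L[ℝ] ℂ) (v w : Fin 2 → ℂ) :
    linPart D (v + w) = linPart D v + linPart D w := by
  simp only [linPart, smul_add, map_add]
  ring

theorem conjPart_smul (D : (Fin 2 → ℂ) →L[ℝ] ℂ) (c : ℂ) (v : Fin 2 → ℂ) :
    conjPart D (c • v) = star c * conjPart D v := by
  have h : Complex.I • c • v = c • Complex.I • v := smul_comm _ _ _
  have hc : star c = c.re - c.im * Complex.I := by
    apply Complex.ext <;> simp
  simp only [conjPart, h]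
  rw [real_linear_smul D c v, real_linear_smul D c (Complex.I • v), real_linear_I_I, hc]
  linear_combination (c.im * D (Complex.I • v) / 2) * Complex.I_mul_I

theorem linPart_smul (D : (Fin 2 → ℂ) →L[ℝ] ℂ) (c : ℂ) (v : Fin 2 → ℂ) :
    linPart D (c • v) = c * linPart D v := by
  have h : Complex.I • c • v = c • Complex.I • v := smul_comm _ _ _
  simp only [linPart, h]
  rw [real_linear_smul D c v, real_linear_smul D c (Complex.I • v), real_linear_I_I]
  nth_rewrite 5 [← Complex.re_add_im c]
  linear_combination (c.im * D (Complex.I • v) / 2) * Complex.I_mul_I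

theorem linPart_add_conjPart (D : (Fin 2 → ℂ) →L[ℝ] ℂ) (v : Fin 2 → ℂ) :
    linPart D v + conjPart D v = D v := by
  simp only [linPart, conjPart]
  ring

theorem conjPart_eq (D : (Fin 2 → ℂ) →L[ℝ] ℂ) (v : Fin 2 → ℂ) :
    conjPart D v = star (v 0) * conjPart D ![1, 0] + star (v 1) * conjPart D ![0, 1] := by
  have h : v = v 0 • ![1, 0] + v 1 • ![0, 1] := by
    ext i
    fin_cases i <;> simp
  conv_lhs => rw [h]
  rw [conjPart_add, conjPart_smul, conjPart_smul]

/-! ### Tangent spaces and `T^{0,1}` of a graph -/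

/-- Near `p`, the set `M` is the graph `w = ρ(z)`. -/
def IsGraphNear (M : Set (Fin 3 → ℂ)) (ρ : (Fin 2 → ℂ) → ℂ) (p : Fin 3 → ℂ) : Prop :=
  ∀ᶠ q in 𝓝 p, (q ∈ M ↔ q 2 = ρ (projZ q))

section Tangent

variable {M : Set (Fin 3 → ℂ)} {ρ : (Fin 2 → ℂ) → ℂ} {p : Fin 3 → ℂ}

theorem hasDerivAt_graphPoint {z : ℝ → Fin 2 → ℂ} {w : ℝ → ℂ} {z' : Fin 2 → ℂ} {w' : ℂ} {t : ℝ}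
    (hz : HasDerivAt z z' t) (hw : HasDerivAt w w' t) :
    HasDerivAt (fun s => graphPoint (z s) (w s)) (graphPoint z' w') t := by
  rw [hasDerivAt_pi] at hz ⊢
  intro i
  fin_cases i
  · exact hz 0
  · exact hz 1
  · exact hw

theorem mem_realTangentSpace_iff (hp : p ∈ M) (hg : IsGraphNear M ρ p)
    (hd : DifferentiableAt ℝ ρ (projZ p)) (v : Fin 3 → ℂ) :
    v ∈ realTangentSpace M p ↔ v 2 = fderiv ℝ ρ (projZ p) (projZ v) := by
  have hp2 : p 2 = ρ (projZ p) := (hg.self_of_nhds).1 hp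
  constructor
  · intro hv
    refine Submodule.span_induction (p := fun v _ => v 2 = fderiv ℝ ρ (projZ p) (projZ v))
      ?_ ?_ ?_ ?_ hv
    · rintro v ⟨γ, h0, hγ, hM⟩
      have hcont : Tendsto γ (𝓝 0) (𝓝 p) := h0 ▸ hγ.continuousAt.tendsto
      have heq : (fun t => γ t 2) =ᶠ[𝓝 0] fun t => ρ (projZ (γ t)) := by
        filter_upwards [hM, hcont.eventually hg] with t h1 h2 using h2.1 h1
      have h1 : HasDerivAt (fun t => γ t 2) (v 2) 0 := (hasDerivAt_pi.1 hγ) 2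
      have h2 : HasDerivAt (fun t => projZ (γ t)) (projZ v) 0 :=
        projZ.hasFDerivAt.comp_hasDerivAt 0 hγ
      have h3 : HasFDerivAt ρ (fderiv ℝ ρ (projZ p)) (projZ (γ 0)) := by
        rw [h0]
        exact hd.hasFDerivAt
      exact h1.unique ((h3.comp_hasDerivAt 0 h2).congr_of_eventuallyEq heq)
    · simp
    · intro v w _ _ h1 h2
      simp [h1, h2]
    · intro c v _ h
      simp [h]
  · intro hv
    apply Submodule.subset_span
    have h1 : HasDerivAt (fun t : ℝ => projZ p + t • projZ v) (projZ v) 0 := by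
      simpa using ((hasDerivAt_id (0 : ℝ)).smul_const (projZ v)).const_add (projZ p)
    have h3 : HasFDerivAt ρ (fderiv ℝ ρ (projZ p)) (projZ p + (0 : ℝ) • projZ v) := by
      simpa using hd.hasFDerivAt
    have h4 := hasDerivAt_graphPoint h1 (h3.comp_hasDerivAt 0 h1)
    rw [← hv, graphPoint_projZ] at h4
    have h0 : graphPoint (projZ p + (0 : ℝ) • projZ v) (ρ (projZ p + (0 : ℝ) • projZ v)) = p := by
      rw [zero_smul, add_zero, ← hp2, graphPoint_projZ]
    refine ⟨_, h0, h4, ?_⟩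
    have hcont := h4.continuousAt.tendsto
    rw [Function.comp_def, h0] at hcont
    filter_upwards [hcont.eventually hg] with t ht
    exact ht.2 (by rw [projZ_graphPoint, graphPoint_two])

theorem mem_T01_iff (hp : p ∈ M) (hg : IsGraphNear M ρ p)
    (hd : DifferentiableAt ℝ ρ (projZ p)) (x : (Fin 3 → ℂ) × (Fin 3 → ℂ)) :
    x ∈ T01 M p ↔ x.1 = 0 ∧ dbar ρ (projZ p) (projZ (star x.2)) = 0 ∧
      star (x.2 2) = fderiv ℝ ρ (projZ p) (projZ (star x.2)) := by
  set D := fderiv ℝ ρ (projZ p) with hD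
  change _ ↔ x.1 = 0 ∧ conjPart D (projZ (star x.2)) = 0 ∧ _
  constructor
  · rintro ⟨hx, hx1⟩
    have hx1 : x.1 = 0 := hx1
    -- These are the complex-linear extensions of `dw = dρ` and of its conjugate, so they can be
    -- checked on the generators `(v, v̄)`.
    have key : x.1 2 = linPart D (projZ x.1) + conjPart D (projZ (star x.2)) ∧
        star (x.2 2) = linPart D (projZ (star x.2)) + conjPart D (projZ x.1) := by
      refine Submodule.span_induction (p := fun x _ =>
        x.1 2 = linPart D (projZ x.1) + conjPart D (projZ (star x.2)) ∧
        star (x.2 2) = linPart D (projZ (star x.2)) + conjPart D (projZ x.1)) ?_ ?_ ?_ ?_ hx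
      · rintro _ ⟨v, hv, rfl⟩
        have := (mem_realTangentSpace_iff hp hg hd v).1 hv
        simp only [star_star, Pi.star_apply, linPart_add_conjPart]
        exact ⟨this, this⟩
      · simp [linPart, conjPart]
      · rintro x y _ _ ⟨h1, h2⟩ ⟨h3, h4⟩
        simp only [Prod.fst_add, Prod.snd_add, Pi.add_apply, star_add, map_add, linPart_add,
          conjPart_add, h1, h2, h3, h4]
        exact ⟨by ring, by ring⟩
      · rintro c x _ ⟨h1, h2⟩
        simp only [Prod.smul_fst, Prod.smul_snd, Pi.smul_apply, star_smul, projZ_smul, linPart_smul,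
          conjPart_smul, h1, h2, smul_eq_mul, star_mul', star_star]
        exact ⟨by ring, by ring⟩
    obtain ⟨k1, k2⟩ := key
    have z1 : linPart D 0 = 0 := by simp [linPart]
    have z2 : conjPart D 0 = 0 := by simp [conjPart]
    rw [hx1, map_zero, z1, zero_add] at k1
    rw [hx1, map_zero, z2, add_zero] at k2
    refine ⟨hx1, k1.symm, ?_⟩
    rw [← linPart_add_conjPart, ← k1, k2]
    simp
  · rintro ⟨h0, h1, h2⟩
    refine ⟨?_, h0⟩
    set u := star x.2 with hu
    -- Both `u` and `iu` are real tangent vectors because `dρ` is complex-linear on `u`; this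
    -- combination cancels the `∂/∂z` part.
    have hx : x = (1 / 2 : ℂ) • (u, star u) +
        (1 / 2 * Complex.I : ℂ) • (Complex.I • u, star (Complex.I • u)) := by
      have e : star u = x.2 := by rw [hu, star_star]
      apply Prod.ext
      · ext i
        simp only [h0, Prod.fst_add, Prod.smul_fst, Pi.add_apply, Pi.smul_apply, smul_eq_mul,
          Pi.zero_apply]
        linear_combination (-u i / 2) * Complex.I_mul_I
      · ext i
        simp only [Prod.snd_add, Prod.smul_snd, Pi.add_apply, Pi.smul_apply, smul_eq_mul,
          star_smul, e, Complex.star_def, Complex.conj_I]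
        linear_combination (x.2 i / 2) * Complex.I_mul_I
    rw [hx]
    have t1 : u 2 = D (projZ u) := h2
    have t2 : (Complex.I • u) 2 = D (projZ (Complex.I • u)) := by
      rw [projZ_smul, Pi.smul_apply, t1, smul_eq_mul]
      have : D (projZ u) + Complex.I * D (Complex.I • projZ u) = 0 := by
        simpa [conjPart] using h1
      linear_combination Complex.I * this - D (Complex.I • projZ u) * Complex.I_mul_I
    refine Submodule.add_mem _ (Submodule.smul_mem _ _ (Submodule.subset_span ?_))
      (Submodule.smul_mem _ _ (Submodule.subset_span ?_))
    · exact ⟨u, (mem_realTangentSpace_iff hp hg hd u).2 t1, rfl⟩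
    · exact ⟨_, (mem_realTangentSpace_iff hp hg hd _).2 t2, rfl⟩

/-- The element of `T^{0,1}` with `∂/∂z̄`-coefficients `a`, at a point of a graph at which the
differential of the graph function is `D`. -/
noncomputable def liftT01 (D : (Fin 2 → ℂ) →L[ℝ] ℂ) (a : Fin 2 → ℂ) :
    (Fin 3 → ℂ) × (Fin 3 → ℂ) :=
  (0, graphPoint a (star (linPart D (star a))))

theorem projZ_star (v : Fin 3 → ℂ) : projZ (star v) = star (projZ v) := by
  ext i
  fin_cases i <;> rfl

theorem liftT01_mem (hp : p ∈ M) (hg : IsGraphNear M ρ p) (hd : DifferentiableAt ℝ ρ (projZ p))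
    {a : Fin 2 → ℂ} (ha : dbar ρ (projZ p) (star a) = 0) :
    liftT01 (fderiv ℝ ρ (projZ p)) a ∈ T01 M p := by
  rw [mem_T01_iff hp hg hd]
  refine ⟨rfl, ?_, ?_⟩
  · simpa [liftT01, projZ_star, projZ_graphPoint] using ha
  · change conjPart (fderiv ℝ ρ (projZ p)) (star a) = 0 at ha
    simp only [liftT01, projZ_star, projZ_graphPoint, graphPoint_two, star_star]
    rw [← linPart_add_conjPart, ha, add_zero]

theorem eq_liftT01 (hp : p ∈ M) (hg : IsGraphNear M ρ p) (hd : DifferentiableAt ℝ ρ (projZ p))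
    {x : (Fin 3 → ℂ) × (Fin 3 → ℂ)} (hx : x ∈ T01 M p) :
    x = liftT01 (fderiv ℝ ρ (projZ p)) (projZ x.2) := by
  obtain ⟨h0, h1, h2⟩ := (mem_T01_iff hp hg hd x).1 hx
  change conjPart (fderiv ℝ ρ (projZ p)) _ = 0 at h1
  rw [← linPart_add_conjPart, h1, add_zero] at h2
  refine Prod.ext h0 ?_
  simp only [liftT01]
  rw [← projZ_star, ← h2, star_star, graphPoint_projZ]

/-- The equation `a₀f + a₁g = 0` with `(f, g) ≠ 0` has the line spanned by `(g, -f)` as its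
solutions. -/
theorem finrank_T01_eq_one (hp : p ∈ M) (hg : IsGraphNear M ρ p)
    (hd : DifferentiableAt ℝ ρ (projZ p))
    (h : dbar ρ (projZ p) ![1, 0] ≠ 0 ∨ dbar ρ (projZ p) ![0, 1] ≠ 0) :
    Module.finrank ℂ (T01 M p) = 1 := by
  set D := fderiv ℝ ρ (projZ p) with hD
  set f := dbar ρ (projZ p) ![1, 0] with hf
  set g := dbar ρ (projZ p) ![0, 1] with hgg
  have hdb : ∀ v, dbar ρ (projZ p) v = star (v 0) * f + star (v 1) * g := conjPart_eq D
  have hspan : T01 M p = Submodule.span ℂ {liftT01 D ![g, -f]} := by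
    apply le_antisymm
    · intro x hx
      rw [Submodule.mem_span_singleton]
      have h1 := ((mem_T01_iff hp hg hd x).1 hx).2.1
      rw [hdb, projZ_apply] at h1
      simp only [Pi.star_apply, star_star, Matrix.cons_val_zero, Matrix.cons_val_one] at h1
      have key : ∀ c : ℂ, c * g = x.2 0 → -(c * f) = x.2 1 → c • liftT01 D ![g, -f] = x := by
        intro c c1 c2
        have hx2 : projZ x.2 = ![c * g, -(c * f)] := by rw [projZ_apply, c1, c2]
        rw [eq_liftT01 hp hg hd hx, hx2]
        have e : star (![c * g, -(c * f)] : Fin 2 → ℂ) = star c • star ![g, -f] := by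
          ext i
          fin_cases i <;> simp
        simp only [liftT01, ← hD, e, linPart_smul]
        apply Prod.ext
        · simp
        · ext i
          fin_cases i <;> simp [graphPoint]
      rcases h with h | h
      · exact ⟨-(x.2 1) / f, key _ (by field_simp; linear_combination -h1) (by field_simp)⟩
      · exact ⟨x.2 0 / g, key _ (by field_simp) (by field_simp; linear_combination -h1)⟩
    · rw [Submodule.span_singleton_le_iff_mem]
      apply liftT01_mem hp hg hd
      rw [hdb]
      simp
      ring
  rw [hspan]
  apply finrank_span_singleton
  intro h0
  have h1 := congrFun (congrArg Prod.snd h0) 0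
  have h2 := congrFun (congrArg Prod.snd h0) 1
  have h1 : g = 0 := h1
  have h2 : -f = 0 := h2
  rcases h with h | h
  · exact h (neg_eq_zero.1 h2)
  · exact h h1

/-- With no condition on the coefficients, `(1, 0)` and `(0, 1)` both lift, and they are not
multiples of one vector. -/
theorem finrank_T01_ne_one (hp : p ∈ M) (hg : IsGraphNear M ρ p)
    (hd : DifferentiableAt ℝ ρ (projZ p)) (h0 : dbar ρ (projZ p) ![1, 0] = 0)
    (h1 : dbar ρ (projZ p) ![0, 1] = 0) : Module.finrank ℂ (T01 M p) ≠ 1 := by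
  intro h
  have hdb : ∀ v, dbar ρ (projZ p) v = 0 := by
    intro v
    have : dbar ρ (projZ p) v = star (v 0) * dbar ρ (projZ p) ![1, 0] +
      star (v 1) * dbar ρ (projZ p) ![0, 1] := conjPart_eq _ v
    rw [this, h0, h1]
    simp
  obtain ⟨v, -, hv⟩ := finrank_eq_one_iff'.1 h
  obtain ⟨c, hc⟩ := hv ⟨_, liftT01_mem hp hg hd (hdb (star ![1, 0]))⟩
  obtain ⟨d, hd'⟩ := hv ⟨_, liftT01_mem hp hg hd (hdb (star ![0, 1]))⟩
  have hc := congrArg (fun y : T01 M p => (y : (Fin 3 → ℂ) × (Fin 3 → ℂ)).2) hc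
  have hd' := congrArg (fun y : T01 M p => (y : (Fin 3 → ℂ) × (Fin 3 → ℂ)).2) hd'
  have c0 : c * (v : (Fin 3 → ℂ) × (Fin 3 → ℂ)).2 0 = 1 := congrFun hc 0
  have c1 : c * (v : (Fin 3 → ℂ) × (Fin 3 → ℂ)).2 1 = 0 := congrFun hc 1
  have d1 : d * (v : (Fin 3 → ℂ) × (Fin 3 → ℂ)).2 1 = 1 := congrFun hd' 1
  have hcne : c ≠ 0 := left_ne_zero_of_mul_eq_one c0
  rw [(mul_eq_zero.1 c1).resolve_left hcne, mul_zero] at d1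
  exact zero_ne_one d1

end Tangent

/-! ### CR points of a graph -/

theorem eventually_isGraphNear {M : Set (Fin 3 → ℂ)} {ρ : (Fin 2 → ℂ) → ℂ} {p : Fin 3 → ℂ}
    (hg : IsGraphNear M ρ p) : ∀ᶠ q in 𝓝 p, IsGraphNear M ρ q :=
  eventually_eventually_nhds.2 hg

theorem tendsto_projZ_zero : Tendsto projZ (𝓝 0) (𝓝 0) := by
  simpa using projZ.continuous.tendsto 0

theorem analyticAt_dbar {ρ : (Fin 2 → ℂ) → ℂ} {z : Fin 2 → ℂ} (h : AnalyticAt ℝ ρ z)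
    (v : Fin 2 → ℂ) : AnalyticAt ℝ (fun z => dbar ρ z v) z := by
  have h1 : ∀ w, AnalyticAt ℝ (fun z => fderiv ℝ ρ z w) z := fun w =>
    ((ContinuousLinearMap.apply ℝ ℂ w).analyticAt _).comp h.fderiv
  unfold dbar
  exact ((h1 v).add (analyticAt_const.mul (h1 _))).div analyticAt_const two_ne_zero

/-- The CR points of a graph are those where `∂̄ρ ≠ 0`, once CR points have CR dimension one. -/
theorem eventually_isCRPoint_iff {M : Set (Fin 3 → ℂ)} {ρ : (Fin 2 → ℂ) → ℂ}
    (hg : IsGraphNear M ρ 0) (hρ : AnalyticAt ℝ ρ 0)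
    (hCRdim : ∀ p, IsCRPoint M p → Module.finrank ℂ (T01 M p) = 1) :
    ∀ᶠ p in 𝓝 (0 : Fin 3 → ℂ), p ∈ M → (IsCRPoint M p ↔
      dbar ρ (projZ p) ![1, 0] ≠ 0 ∨ dbar ρ (projZ p) ![0, 1] ≠ 0) := by
  have hev : ∀ᶠ p in 𝓝 (0 : Fin 3 → ℂ), IsGraphNear M ρ p ∧ AnalyticAt ℝ ρ (projZ p) :=
    (eventually_isGraphNear hg).and (tendsto_projZ_zero.eventually hρ.eventually_analyticAt)
  filter_upwards [eventually_eventually_nhds.2 hev] with p hpev hp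
  obtain ⟨hgp, hap⟩ := hpev.self_of_nhds
  constructor
  · intro hcr
    by_contra hcon
    push Not at hcon
    exact finrank_T01_ne_one hp hgp hap.differentiableAt hcon.1 hcon.2 (hCRdim p hcr)
  · intro h
    refine ⟨hp, ?_⟩
    rw [finrank_T01_eq_one hp hgp hap.differentiableAt h]
    have hc : ∀ v, Tendsto (fun q => dbar ρ (projZ q) v) (𝓝 p) (𝓝 (dbar ρ (projZ p) v)) :=
      fun v => (analyticAt_dbar hap v).continuousAt.tendsto.comp projZ.continuous.continuousAt
    have hne : ∀ᶠ q in 𝓝 p, dbar ρ (projZ q) ![1, 0] ≠ 0 ∨ dbar ρ (projZ q) ![0, 1] ≠ 0 := by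
      rcases h with h | h
      · exact ((hc _).eventually_ne h).mono fun q hq => Or.inl hq
      · exact ((hc _).eventually_ne h).mono fun q hq => Or.inr hq
    rw [eventually_nhdsWithin_iff]
    filter_upwards [hpev, hne] with q h1 h2 hq
    exact finrank_T01_eq_one hq h1.1 h1.2.differentiableAt h2

/-! ### First-order expansion of `∂̄ρ` at the origin -/

theorem fderiv_fderiv_eq_zero_of_isBigO {V W : Type*} [NormedAddCommGroup V] [NormedSpace ℝ V]
    [NormedAddCommGroup W] [NormedSpace ℝ W] [CompleteSpace W] {E : V → W}
    (hE : AnalyticAt ℝ E 0) (hE3 : E =O[𝓝 0] fun z => ‖z‖ ^ 3) :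
    fderiv ℝ (fderiv ℝ E) 0 = 0 := by
  obtain ⟨p, r, hp⟩ := hE
  have hpa : HasFPowerSeriesAt E p 0 := ⟨r, hp⟩
  have hpow : ∀ m n : ℕ, m ≤ n → (fun z : V => ‖z‖ ^ n) =O[𝓝 0] fun z => ‖z‖ ^ m := by
    intro m n hmn
    apply IsBigO.of_bound 1
    filter_upwards [Metric.ball_mem_nhds (0 : V) one_pos] with z hz
    rw [mem_ball_zero_iff] at hz
    simpa using pow_le_pow_of_le_one (norm_nonneg z) hz.le hmn
  -- Subtracting the Taylor remainder shows that each partial sum is as small as `E`; a homogeneous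
  -- term of degree `k` that is `O(‖y‖^(k+1))` vanishes on the diagonal.
  have hsum : ∀ n ≤ 3, (fun y => p.partialSum n y) =O[𝓝 0] fun y => ‖y‖ ^ n := by
    intro n hn
    have h := (hE3.trans (hpow n 3 hn)).sub (by simpa using hpa.isBigO_sub_partialSum_pow n)
    simpa using h
  have h0 : ∀ y, (p 0 fun _ => y) = 0 := by
    apply IsBigO.continuousMultilinearMap_apply_eq_zero
    simpa [FormalMultilinearSeries.partialSum] using hsum 1 (by norm_num)
  have h1 : ∀ y, (p 1 fun _ => y) = 0 := by
    apply IsBigO.continuousMultilinearMap_apply_eq_zero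
    simpa [FormalMultilinearSeries.partialSum, Finset.sum_range_succ, h0] using
      hsum 2 (by norm_num)
  have h2 : ∀ y, (p 2 fun _ => y) = 0 := by
    apply IsBigO.continuousMultilinearMap_apply_eq_zero
    simpa [FormalMultilinearSeries.partialSum, Finset.sum_range_succ, h0, h1] using
      hsum 3 le_rfl
  ext u v
  have h3 := hp.iteratedFDeriv_eq_sum_of_completeSpace ![u, v]
  have huniv : (Finset.univ : Finset (Equiv.Perm (Fin 2))) = {1, Equiv.swap 0 1} := by decide
  rw [iteratedFDeriv_two_apply, huniv, Finset.sum_pair (by decide)] at h3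
  have e1 : (fun i => (![u, v] : Fin 2 → V) ((1 : Equiv.Perm (Fin 2)) i)) = ![u, v] := by
    ext i; simp
  have e2 : (fun i => (![u, v] : Fin 2 → V) ((Equiv.swap 0 1 : Equiv.Perm (Fin 2)) i))
      = ![v, u] := by
    ext i; fin_cases i <;> simp
  rw [e1, e2] at h3
  -- Polarization: the coefficient `p 2` need not be symmetric, but the second derivative is its
  -- symmetrization, which the diagonal values determine.
  have h5 : (p 2 fun _ => u + v) = (p 2 fun _ => u) + (p 2 fun _ => v) +
      (p 2 ![u, v] + p 2 ![v, u]) := by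
    have c1 : ∀ w : V, (fun _ => w) = (![w, w] : Fin 2 → V) := by
      intro w; ext i; fin_cases i <;> rfl
    have a2 : ∀ w a b : V, p 2 ![w, a + b] = p 2 ![w, a] + p 2 ![w, b] := by
      intro w a b
      have h := (p 2).map_update_add ![w, a] 1 a b
      have e : ∀ x, Function.update ![w, a] 1 x = ![w, x] := by
        intro x; ext i; fin_cases i <;> simp
      rwa [e, e, e] at h
    have a3 : ∀ w a b : V, p 2 ![a + b, w] = p 2 ![a, w] + p 2 ![b, w] := by
      intro w a b
      have h := (p 2).map_update_add ![a, w] 0 a b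
      have e : ∀ x, Function.update ![a, w] 0 x = ![x, w] := by
        intro x; ext i; fin_cases i <;> simp
      rwa [e, e, e] at h
    rw [c1, c1, c1, a2, a3, a3]
    abel
  rw [h2, h2, h2, zero_add, zero_add] at h5
  simpa [← h5] using h3

theorem hasFDerivAt_dbar_zero {ρ : (Fin 2 → ℂ) → ℂ} (hρ : AnalyticAt ℝ ρ 0)
    (h2 : fderiv ℝ (fderiv ℝ ρ) 0 = 0) (v : Fin 2 → ℂ) :
    HasFDerivAt (𝕜 := ℝ) (fun z => dbar ρ z v) 0 0 := by
  have h := hρ.fderiv.differentiableAt.hasFDerivAt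
  rw [h2] at h
  have h1 : ∀ w, HasFDerivAt (𝕜 := ℝ) (fun z => fderiv ℝ ρ z w) 0 0 := fun w => by
    simpa using h.clm_apply (hasFDerivAt_const w 0)
  unfold dbar
  have h3 := ((h1 v).add ((h1 (Complex.I • v)).const_mul Complex.I)).mul_const (2 : ℂ)⁻¹
  simp only [div_eq_mul_inv]
  exact h3.congr_fderiv (by ext; simp)

/-- The real-linear map `z ↦ p · z + q · z̄`. -/
noncomputable def linForm (p q : Fin 2 → ℂ) : (Fin 2 → ℂ) →L[ℝ] ℂ :=
  ∑ j, (p j • ContinuousLinearMap.proj (R := ℝ) (φ := fun _ : Fin 2 => ℂ) j +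
    q j • (Complex.conjCLE : ℂ →L[ℝ] ℂ).comp
      (ContinuousLinearMap.proj (R := ℝ) (φ := fun _ : Fin 2 => ℂ) j))

theorem linForm_apply (p q z : Fin 2 → ℂ) : linForm p q z =
    p 0 * z 0 + p 1 * z 1 + (q 0 * star (z 0) + q 1 * star (z 1)) := by
  simp [linForm, Fin.sum_univ_two]
  ring

theorem IsQuadraticInZZbar.analyticAt {Q : (Fin 2 → ℂ) → ℂ} (hQ : IsQuadraticInZZbar Q)
    (z : Fin 2 → ℂ) : AnalyticAt ℝ Q z := by
  obtain ⟨A, B, C, h⟩ := hQ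
  have h1 : ∀ j, AnalyticAt ℝ (fun z : Fin 2 → ℂ => z j) z := fun j =>
    (ContinuousLinearMap.proj (R := ℝ) (φ := fun _ : Fin 2 => ℂ) j).analyticAt z
  have h2 : ∀ j, AnalyticAt ℝ (fun z : Fin 2 → ℂ => star (z j)) z := fun j =>
    ((Complex.conjCLE : ℂ →L[ℝ] ℂ).comp
      (ContinuousLinearMap.proj (R := ℝ) (φ := fun _ : Fin 2 => ℂ) j)).analyticAt z
  rw [funext h]
  refine Finset.analyticAt_fun_sum _ fun j _ => Finset.analyticAt_fun_sum _ fun k _ => ?_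
  exact (((analyticAt_const.mul (h1 j)).mul (h1 k)).add ((analyticAt_const.mul (h1 j)).mul
    (h2 k))).add ((analyticAt_const.mul (h2 j)).mul (h2 k))

/-- `∂̄Q = ∑ₖ (∑ⱼ (Bⱼₖ zⱼ + Sⱼₖ z̄ⱼ)) dz̄ₖ` with `S` symmetric, for a quadratic form `Q`. -/
theorem IsQuadraticInZZbar.dbar_eq {Q : (Fin 2 → ℂ) → ℂ} (hQ : IsQuadraticInZZbar Q) :
    ∃ B S : Fin 2 → Fin 2 → ℂ, S 0 1 = S 1 0 ∧ ∀ z v, dbar Q z v =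
      star (v 0) * linForm (B 0) (S 0) z + star (v 1) * linForm (B 1) (S 1) z := by
  obtain ⟨A, B, C, h⟩ := id hQ
  refine ⟨fun k j => B j k, fun k j => C j k + C k j, add_comm _ _, ?_⟩
  have hd : ∀ z v, fderiv ℝ Q z v = ∑ j, ∑ k, (A j k * (v j * z k + z j * v k) +
      B j k * (v j * star (z k) + z j * star (v k)) +
      C j k * (star (v j) * star (z k) + star (z j) * star (v k))) := by
    intro z v
    set L := ∑ j, ∑ k, (A j k * (v j * z k + z j * v k) +
      B j k * (v j * star (z k) + z j * star (v k)) +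
      C j k * (star (v j) * star (z k) + star (z j) * star (v k))) with hL
    have h1 : HasDerivAt (fun t : ℝ => z + t • v) v 0 := by
      simpa using ((hasDerivAt_id (0 : ℝ)).smul_const v).const_add z
    have h2 : HasFDerivAt Q (fderiv ℝ Q z) (z + (0 : ℝ) • v) := by
      simpa using (hQ.analyticAt z).differentiableAt.hasFDerivAt
    have h3 := h2.comp_hasDerivAt 0 h1
    -- On a line a quadratic form is a polynomial in `t`, and the derivative is its linear
    -- coefficient.
    have h4 : Q ∘ (fun t : ℝ => z + t • v) = fun t : ℝ => Q z + (t * L + t ^ 2 * Q v) := by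
      ext t
      simp only [Function.comp_apply, h, hL, Fin.sum_univ_two, Pi.add_apply, Pi.smul_apply,
        Complex.real_smul, star_add, star_mul', Complex.star_def, Complex.conj_ofReal]
      ring
    rw [h4] at h3
    have h5 : HasDerivAt (fun t : ℝ => (t : ℂ)) 1 (0 : ℝ) := Complex.ofRealCLM.hasDerivAt
    have h6 := ((h5.mul_const L).add ((h5.pow 2).mul_const (Q v))).const_add (Q z)
    have h7 := h3.unique h6
    simpa using h7
  intro z v
  simp only [dbar, hd, linForm_apply, Fin.sum_univ_two, Pi.smul_apply, smul_eq_mul, star_mul',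
    Complex.star_def, Complex.conj_I]
  ring_nf
  simp only [Complex.I_sq]
  ring

/-! ### Linear algebra of the quadratic model -/

/-- The real determinant of `x ↦ ax + ex̄` is `|a|² - |e|²`; the solution is Cramer's rule for the
equation and its conjugate. -/
theorem exists_mul_add_mul_conj_eq {a e : ℂ} (h : ‖a‖ ≠ ‖e‖) (y : ℂ) :
    ∃ x : ℂ, a * x + e * star x = y := by
  have hd : a * star a - e * star e ≠ 0 := by
    intro h0
    apply h
    rw [sub_eq_zero, Complex.star_def, Complex.mul_conj, Complex.mul_conj,
      Complex.ofReal_inj] at h0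
    rw [← Real.sqrt_sq (norm_nonneg a), ← Real.sqrt_sq (norm_nonneg e), ← Complex.normSq_eq_norm_sq,
      ← Complex.normSq_eq_norm_sq, h0]
  have hs : star (a * star a - e * star e) = a * star a - e * star e := by
    simp only [star_sub, star_mul', star_star]
    ring
  refine ⟨(star a * y - e * star y) / (a * star a - e * star e), ?_⟩
  rw [star_div₀, hs]
  simp only [star_sub, star_mul', star_star]
  field_simp
  ring

/-- With `e = aμ²` and `|μ| = 1`, one has `ax + ex̄ = aμ(μ̄x + μx̄)`, so the rotated coordinate `ζ₁
= μ̄x` brings the form to `a(ζ₁ + ζ̄₁) dζ̄₁`. The second row of the matrix only makes it invertible.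
-/
theorem correspondsToParabolicBishop_of_eq {Q : (Fin 2 → ℂ) → ℂ} {η : Fin 2 → ℂ} {a e : ℂ}
    (hη : η 0 * star (η 0) + η 1 * star (η 1) ≠ 0) (ha : a ≠ 0) (hae : ‖a‖ = ‖e‖)
    (h : ∀ z v, dbar Q z v = (a * (star (η 0) * z 0 + star (η 1) * z 1) +
      e * star (star (η 0) * z 0 + star (η 1) * z 1)) *
        star (star (η 0) * v 0 + star (η 1) * v 1)) :
    CorrespondsToParabolicBishop Q := by
  obtain ⟨μ, hμ⟩ := IsAlgClosed.exists_pow_nat_eq (e / a) two_pos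
  have hμ1 : ‖μ‖ = 1 := by
    have h2 : ‖μ‖ ^ 2 = 1 := by
      rw [← norm_pow, hμ, norm_div, ← hae, div_self (norm_ne_zero_iff.2 ha)]
    exact (pow_eq_one_iff_of_nonneg (norm_nonneg _) two_ne_zero).1 h2
  have hμμ : μ * star μ = 1 := by
    rw [Complex.star_def, Complex.mul_conj, Complex.normSq_eq_norm_sq, hμ1]
    simp
  have he : e = a * μ ^ 2 := by
    rw [hμ]
    field_simp
  set A : Matrix (Fin 2) (Fin 2) ℂ :=
    !![star μ * star (η 0), star μ * star (η 1); -(η 1), η 0] with hA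
  have hdet : IsUnit A.det := by
    rw [isUnit_iff_ne_zero, hA, Matrix.det_fin_two_of]
    have : star μ * star (η 0) * η 0 - star μ * star (η 1) * -(η 1) =
      star μ * (η 0 * star (η 0) + η 1 * star (η 1)) := by ring
    rw [this]
    exact mul_ne_zero (right_ne_zero_of_mul_eq_one hμμ) hη
  refine ⟨a, Matrix.toLinearEquiv' A ((Matrix.isUnit_iff_isUnit_det A).2 hdet).invertible, ha, ?_⟩
  intro z v
  have hT : ∀ z, (Matrix.toLinearEquiv' A
      ((Matrix.isUnit_iff_isUnit_det A).2 hdet).invertible) z 0 =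
      star μ * (star (η 0) * z 0 + star (η 1) * z 1) := by
    intro z
    change A.mulVec z 0 = _
    simp [hA, Matrix.mulVec, dotProduct, Fin.sum_univ_two]
    ring
  rw [h, parabolicForm, hT, hT, he]
  generalize star (η 0) * z 0 + star (η 1) * z 1 = x
  generalize star (η 0) * v 0 + star (η 1) * v 1 = y
  simp only [star_mul', star_star]
  linear_combination (-(a * x * star y)) * hμμ

/-- If the coefficients of `∂̄Q` satisfy a nontrivial linear relation, the combination of
them along the conjugate vector is onto `ℂ`, unless `Q` is parabolic or `∂̄Q = 0`. -/
theorem surjective_linForm_of_relation {Q : (Fin 2 → ℂ) → ℂ} {B S : Fin 2 → Fin 2 → ℂ}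
    (hS : S 0 1 = S 1 0)
    (hQ : ∀ z v, dbar Q z v =
      star (v 0) * linForm (B 0) (S 0) z + star (v 1) * linForm (B 1) (S 1) z)
    (hQ0 : ∃ z v, dbar Q z v ≠ 0) (hnp : ¬ CorrespondsToParabolicBishop Q)
    {b : Fin 2 → ℂ} (hb : b ≠ 0)
    (hrel : ∀ z, b 0 * linForm (B 0) (S 0) z + b 1 * linForm (B 1) (S 1) z = 0) :
    ∀ y, ∃ z, star (b 1) * linForm (B 0) (S 0) z - star (b 0) * linForm (B 1) (S 1) z = y := by
  set N : ℂ := b 0 * star (b 0) + b 1 * star (b 1) with hN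
  have hN0 : N ≠ 0 := by
    intro h0
    apply hb
    have h1 : Complex.normSq (b 0) + Complex.normSq (b 1) = 0 := by
      rw [hN, Complex.star_def, Complex.mul_conj, Complex.mul_conj] at h0
      exact_mod_cast h0
    have n0 := Complex.normSq_nonneg (b 0)
    have n1 := Complex.normSq_nonneg (b 1)
    have b0 : b 0 = 0 := Complex.normSq_eq_zero.1 (by linarith)
    have b1 : b 1 = 0 := Complex.normSq_eq_zero.1 (by linarith)
    ext i
    fin_cases i
    · exact b0
    · exact b1
  -- Evaluating at `eⱼ` and `i eⱼ` separates the coefficients of `zⱼ` and `z̄ⱼ`.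
  have hrelc : ∀ j, b 0 * B 0 j + b 1 * B 1 j = 0 ∧ b 0 * S 0 j + b 1 * S 1 j = 0 := by
    intro j
    have r1 := hrel (Pi.single j 1)
    have r2 := hrel (Pi.single j Complex.I)
    fin_cases j
    · simp [linForm_apply] at r1 r2 ⊢
      constructor
      · linear_combination r1 / 2 - Complex.I * r2 / 2 +
          (b 0 * B 0 0 + b 1 * B 1 0 - b 0 * S 0 0 - b 1 * S 1 0) / 2 * Complex.I_mul_I
      · linear_combination r1 / 2 + Complex.I * r2 / 2 -
          (b 0 * B 0 0 + b 1 * B 1 0 - b 0 * S 0 0 - b 1 * S 1 0) / 2 * Complex.I_mul_I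
    · simp [linForm_apply] at r1 r2 ⊢
      constructor
      · linear_combination r1 / 2 - Complex.I * r2 / 2 +
          (b 0 * B 0 1 + b 1 * B 1 1 - b 0 * S 0 1 - b 1 * S 1 1) / 2 * Complex.I_mul_I
      · linear_combination r1 / 2 + Complex.I * r2 / 2 -
          (b 0 * B 0 1 + b 1 * B 1 1 - b 0 * S 0 1 - b 1 * S 1 1) / 2 * Complex.I_mul_I
  set p : Fin 2 → ℂ := fun j => star (b 1) * B 0 j - star (b 0) * B 1 j with hp
  set q : Fin 2 → ℂ := fun j => star (b 1) * S 0 j - star (b 0) * S 1 j with hq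
  have hL : ∀ z, star (b 1) * linForm (B 0) (S 0) z - star (b 0) * linForm (B 1) (S 1) z =
      linForm p q z := by
    intro z
    simp only [linForm_apply, hp, hq]
    ring
  simp only [hL]
  -- `q` is a multiple of `(b₁, -b₀)`
  have hbq : b 0 * q 0 + b 1 * q 1 = 0 := by
    simp only [hq]
    linear_combination star (b 1) * (hrelc 0).2 - star (b 0) * (hrelc 1).2 +
      (star (b 1) * b 1 + star (b 0) * b 0) * hS
  obtain ⟨e, he0, he1⟩ : ∃ e, q 0 = e * b 1 ∧ q 1 = -(e * b 0) := by
    refine ⟨(q 0 * star (b 1) - q 1 * star (b 0)) / N, ?_, ?_⟩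
    · field_simp
      rw [hN]
      linear_combination star (b 0) * hbq
    · field_simp
      rw [hN]
      linear_combination star (b 1) * hbq
  -- On multiples of `b̄` the `z̄` part vanishes by `hbq`, so a nonzero value of `p` on `b̄` already
  -- gives surjectivity. Otherwise the form depends only on `ζ = b̄₁z₀ - b̄₀z₁`.
  by_cases hbp : star (b 0) * p 0 + star (b 1) * p 1 = 0
  swap
  · intro y
    refine ⟨(y / (star (b 0) * p 0 + star (b 1) * p 1)) • star b, ?_⟩
    simp only [linForm_apply, Pi.smul_apply, smul_eq_mul, Pi.star_apply, star_mul', star_star]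
    have : ∀ c d : ℂ, p 0 * (c * star (b 0)) + p 1 * (c * star (b 1)) +
      (q 0 * (d * b 0) + q 1 * (d * b 1)) = c * (star (b 0) * p 0 + star (b 1) * p 1) := by
      intro c d
      linear_combination d * hbq
    rw [this, div_mul_cancel₀ _ hbp]
  obtain ⟨a, ha0, ha1⟩ : ∃ a, p 0 = a * star (b 1) ∧ p 1 = -(a * star (b 0)) := by
    refine ⟨(p 0 * b 1 - p 1 * b 0) / N, ?_, ?_⟩
    · field_simp
      rw [hN]
      linear_combination b 0 * hbp
    · field_simp
      rw [hN]
      linear_combination b 1 * hbp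
  have hform : ∀ z, linForm p q z = a * (star (b 1) * z 0 - star (b 0) * z 1) +
      e * star (star (b 1) * z 0 - star (b 0) * z 1) := by
    intro z
    simp only [linForm_apply, ha0, ha1, he0, he1, star_sub, star_mul', star_star]
    ring
  by_cases hae : ‖a‖ = ‖e‖
  swap
  · intro y
    obtain ⟨x, hx⟩ := exists_mul_add_mul_conj_eq hae y
    refine ⟨![x * b 1 / N, -(x * b 0 / N)], ?_⟩
    have : star (b 1) * (x * b 1 / N) - star (b 0) * -(x * b 0 / N) = x := by
      field_simp
      rw [hN]
      ring
    rw [hform]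
    simpa only [Matrix.cons_val_zero, Matrix.cons_val_one, this] using hx
  exfalso
  -- The relation makes `∂̄Q` a multiple of `dζ̄`, so `|a| = |e|` forces the zero or the parabolic
  -- case.
  have hdb : ∀ z v, dbar Q z v = linForm p q z / N * (b 1 * star (v 0) - b 0 * star (v 1)) := by
    intro z v
    rw [hQ, ← hL]
    field_simp
    rw [hN]
    linear_combination (star (v 0) * star (b 0) + star (v 1) * star (b 1)) * hrel z
  by_cases ha : a = 0
  · obtain ⟨z, v, hzv⟩ := hQ0
    have he : e = 0 := by
      rw [ha, norm_zero] at hae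
      exact norm_eq_zero.1 hae.symm
    apply hzv
    rw [hdb, hform, ha, he]
    simp
  · refine hnp (correspondsToParabolicBishop_of_eq (η := ![b 1, -b 0]) (a := a / N) (e := e / N)
      ?_ (div_ne_zero ha hN0) (by rw [norm_div, norm_div, hae]) ?_)
    · intro h0
      apply hN0
      rw [hN]
      simp at h0
      simp
      linear_combination h0
    · intro z v
      rw [hdb, hform]
      simp only [Matrix.cons_val_zero, Matrix.cons_val_one, star_neg, star_add, star_sub,
        star_mul', star_star]
      ring

/-! ### Two complex equations and the dimension of their zero set -/

theorem isAnalyticSubmanifoldAt_four {X : Set (Fin 3 → ℂ)} {p : Fin 3 → ℂ}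
    {F G : (Fin 3 → ℂ) → ℂ} (hp : p ∈ X) (hF : AnalyticAt ℝ F p) (hG : AnalyticAt ℝ G p)
    (hsurj : ∀ y y', ∃ v, fderiv ℝ F p v = y ∧ fderiv ℝ G p v = y')
    (hX : ∀ᶠ x in 𝓝 p, (x ∈ X ↔ F x = 0 ∧ G x = 0)) : IsAnalyticSubmanifoldAt X 4 p := by
  have hre : ∀ {H : (Fin 3 → ℂ) → ℂ}, AnalyticAt ℝ H p → AnalyticAt ℝ (fun x => (H x).re) p :=
    fun h => (Complex.reCLM.analyticAt _).comp h
  have him : ∀ {H : (Fin 3 → ℂ) → ℂ}, AnalyticAt ℝ H p → AnalyticAt ℝ (fun x => (H x).im) p :=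
    fun h => (Complex.imCLM.analyticAt _).comp h
  set Φ : Fin 4 → (Fin 3 → ℂ) → ℝ :=
    ![fun x => (F x).re, fun x => (F x).im, fun x => (G x).re, fun x => (G x).im] with hΦ
  have hΦa : ∀ i, AnalyticAt ℝ (Φ i) p := by
    intro i
    fin_cases i
    · exact hre hF
    · exact him hF
    · exact hre hG
    · exact him hG
  refine ⟨hp, fun x i => Φ i x, AnalyticAt.pi hΦa, ?_, ?_⟩
  · intro y
    obtain ⟨v, hv1, hv2⟩ := hsurj ⟨y 0, y 1⟩ ⟨y 2, y 3⟩
    refine ⟨v, ?_⟩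
    rw [fderiv_pi fun i => (hΦa i).differentiableAt]
    have r1 : ∀ {H : (Fin 3 → ℂ) → ℂ}, AnalyticAt ℝ H p →
        fderiv ℝ (fun x => (H x).re) p v = (fderiv ℝ H p v).re := fun h => by
      have h1 := (Complex.reCLM.hasFDerivAt.comp p h.differentiableAt.hasFDerivAt).fderiv
      exact congrArg (fun L : (Fin 3 → ℂ) →L[ℝ] ℝ => L v) h1
    have r2 : ∀ {H : (Fin 3 → ℂ) → ℂ}, AnalyticAt ℝ H p →
        fderiv ℝ (fun x => (H x).im) p v = (fderiv ℝ H p v).im := fun h => by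
      have h1 := (Complex.imCLM.hasFDerivAt.comp p h.differentiableAt.hasFDerivAt).fderiv
      exact congrArg (fun L : (Fin 3 → ℂ) →L[ℝ] ℝ => L v) h1
    ext i
    fin_cases i
    · exact (r1 hF).trans (by rw [hv1]; rfl)
    · exact (r2 hF).trans (by rw [hv1]; rfl)
    · exact (r1 hG).trans (by rw [hv2]; rfl)
    · exact (r2 hG).trans (by rw [hv2]; rfl)
  · filter_upwards [hX] with x hx
    rw [hx, Complex.ext_iff, Complex.ext_iff, funext_iff]
    simp [hΦ, Fin.forall_fin_succ, and_assoc]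

theorem two_le_varietyDimAt {X : Set (Fin 3 → ℂ)} {p : Fin 3 → ℂ}
    (h : IsAnalyticSubmanifoldAt X 4 p) : 2 ≤ varietyDimAt X p := by
  refine le_iInf₂ fun U hU => le_sSup ?_
  exact ⟨p, mem_of_mem_nhds hU, 2, 4, rfl, h, rfl⟩

theorem IsQuadraticInZZbar.hasFDerivAt_dbar_add {Q E : (Fin 2 → ℂ) → ℂ}
    (hQ : IsQuadraticInZZbar Q) (hE : AnalyticAt ℝ E 0) (hE3 : E =O[𝓝 0] fun z => ‖z‖ ^ 3)
    {v : Fin 2 → ℂ} {L : (Fin 2 → ℂ) →L[ℝ] ℂ} (hL : ∀ z, dbar Q z v = L z) :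
    dbar (fun z => Q z + E z) 0 v = 0 ∧
      HasFDerivAt (fun z => dbar (fun z => Q z + E z) z v) L 0 := by
  have heq : (fun z => dbar (fun z => Q z + E z) z v) =ᶠ[𝓝 0] fun z => L z + dbar E z v := by
    filter_upwards [hE.eventually_analyticAt] with z hz
    rw [← hL]
    unfold dbar
    have : fderiv ℝ (fun z => Q z + E z) z = fderiv ℝ Q z + fderiv ℝ E z :=
      fderiv_add (hQ.analyticAt z).differentiableAt hz.differentiableAt
    simp only [this, add_apply]
    ring
  have hE0 : fderiv ℝ E 0 = 0 := by
    refine HasFDerivAt.fderiv (IsBigO.hasFDerivAt (n := 3) ?_ (by norm_num))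
    simpa using hE3
  constructor
  · refine heq.self_of_nhds.trans ?_
    simp [dbar, hE0]
  · have h1 := L.hasFDerivAt.add
      (hasFDerivAt_dbar_zero hE (fderiv_fderiv_eq_zero_of_isBigO hE hE3) v) (x := 0)
    rw [add_zero] at h1
    exact h1.congr_of_eventuallyEq heq

/-! ### The relation forced by a removable singularity -/

theorem liftT01_zero (D : (Fin 2 → ℂ) →L[ℝ] ℂ) : liftT01 D 0 = 0 := by
  apply Prod.ext
  · rfl
  · ext i
    fin_cases i <;> simp [liftT01, graphPoint, linPart]

/-- At a removable CR singularity of a graph whose CR points, of CR dimension one, accumulate along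
a ray, the coefficients of `∂̄ρ` satisfy a linear relation with real-analytic coefficients that do
not all vanish. -/
theorem exists_relation_of_isRemovable {M : Set (Fin 3 → ℂ)} {ρ : (Fin 2 → ℂ) → ℂ}
    (hCRdim : ∀ p, IsCRPoint M p → Module.finrank ℂ (T01 M p) = 1)
    (hg : IsGraphNear M ρ 0) (hρ : AnalyticAt ℝ ρ 0) (hρ0 : ρ 0 = 0)
    {z₀ : Fin 2 → ℂ} (hz₀ : ∀ᶠ t : ℝ in 𝓝[≠] 0,
      dbar ρ (t • z₀) ![1, 0] ≠ 0 ∨ dbar ρ (t • z₀) ![0, 1] ≠ 0)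
    (hrem : IsRemovableCRSingularity M 0) :
    ∃ b c : (Fin 2 → ℂ) → ℂ, AnalyticAt ℝ b 0 ∧ AnalyticAt ℝ c 0 ∧ ¬(b 0 = 0 ∧ c 0 = 0) ∧
      ∀ᶠ z in 𝓝 0, b z * dbar ρ z ![1, 0] + c z * dbar ρ z ![0, 1] = 0 := by
  obtain ⟨h0M, U, V, hUo, h0U, hV, hVT⟩ := hrem
  obtain ⟨hle, r, s, hs, hsp⟩ := hV 0 ⟨h0M, h0U⟩
  set σ : (Fin 2 → ℂ) → (Fin 3 → ℂ) := fun z => graphPoint z (ρ z) with hσ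
  have hσ0 : σ 0 = 0 := by
    ext i
    fin_cases i <;> simp [hσ, graphPoint, hρ0]
  have hσa : AnalyticAt ℝ σ 0 := by
    refine AnalyticAt.pi fun i => ?_
    fin_cases i
    · exact (ContinuousLinearMap.proj (R := ℝ) (φ := fun _ : Fin 2 => ℂ) 0).analyticAt 0
    · exact (ContinuousLinearMap.proj (R := ℝ) (φ := fun _ : Fin 2 => ℂ) 1).analyticAt 0
    · exact hρ
  have hσt : Tendsto σ (𝓝 0) (𝓝 0) := by
    simpa [hσ0] using hσa.continuousAt.tendsto
  have hσM : Tendsto σ (𝓝 0) (𝓝[M] 0) := by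
    refine tendsto_nhdsWithin_iff.2 ⟨hσt, ?_⟩
    filter_upwards [hσt.eventually hg] with z hz
    exact hz.2 (by simp only [hσ, graphPoint_two, projZ_graphPoint])
  have hcr : ∀ᶠ z in 𝓝 0, (IsCRPoint M (σ z) ↔
      dbar ρ z ![1, 0] ≠ 0 ∨ dbar ρ z ![0, 1] ≠ 0) := by
    have hM := (tendsto_nhdsWithin_iff.1 hσM).2
    filter_upwards [hM, hσt.eventually (eventually_isCRPoint_iff hg hρ hCRdim)] with z h1 h2
    simpa only [hσ, projZ_graphPoint] using h2 h1
  have hspσ := hσM.eventually hsp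
  have hUσ : ∀ᶠ z in 𝓝 0, σ z ∈ U := hσt.eventually (hUo.mem_nhds h0U)
  have hray : Tendsto (fun t : ℝ => t • z₀) (𝓝[≠] 0) (𝓝 0) := by
    have : Tendsto (fun t : ℝ => t • z₀) (𝓝 0) (𝓝 ((0 : ℝ) • z₀)) :=
      (continuous_id.smul continuous_const).tendsto 0
    rw [zero_smul] at this
    exact this.mono_left nhdsWithin_le_nhds
  have hrayCR : ∀ᶠ t : ℝ in 𝓝[≠] 0, IsCRPoint M (σ (t • z₀)) := by
    filter_upwards [hray.eventually hcr, hz₀] with t h1 h2 using h1.2 h2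
  -- The rank is positive because the fibre is one-dimensional at the CR points on the ray.
  have hr : Nonempty (Fin r) := by
    obtain ⟨t, h1, h2, h3⟩ := (hrayCR.and ((hray.eventually hspσ).and
      (hray.eventually hUσ))).exists
    by_contra hemp
    rw [not_nonempty_iff] at hemp
    have h4 := h2.2
    rw [Set.range_eq_empty, Submodule.span_empty, hVT _ h3 h1] at h4
    have h5 := hCRdim _ h1
    rw [← h4, finrank_bot] at h5
    exact zero_ne_one h5
  obtain ⟨i⟩ := hr
  have hmem : ∀ᶠ z in 𝓝 0, IsCRPoint M (σ z) → s i (σ z) ∈ T01 M (σ z) := by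
    filter_upwards [hspσ, hUσ] with z h1 h2 h3
    rw [← hVT _ h2 h3, ← h1.2]
    exact Submodule.subset_span ⟨i, rfl⟩
  have hsσ : AnalyticAt ℝ (fun z => s i (σ z)) 0 := by
    have := hs i
    rw [← hσ0] at this
    exact this.comp hσa
  -- The section lies in `T^{0,1}` at the CR points of the ray, and this condition on its `∂/∂z`
  -- part passes to the limit `0`, which need not be a CR point.
  have hfst : (s i 0).1 = 0 := by
    have h1 : Tendsto (fun t : ℝ => (s i (σ (t • z₀))).1) (𝓝[≠] 0) (𝓝 (s i 0).1) := by
      have h2 := hsσ.continuousAt.tendsto.comp hray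
      rw [hσ0] at h2
      exact (continuous_fst.tendsto _).comp h2
    refine tendsto_nhds_unique_of_eventuallyEq h1 tendsto_const_nhds ?_
    filter_upwards [hray.eventually hmem, hrayCR] with t h2 h3
    exact (h2 h3).2
  have h0 := hsp.self_of_nhdsWithin h0M
  have hT0 : s i 0 ∈ T01 M 0 := ⟨hle (h0.2 ▸ Submodule.subset_span ⟨i, rfl⟩), hfst⟩
  have hsnd : ∀ j, AnalyticAt ℝ (fun z => (s i (σ z)).2 j) 0 := fun j =>
    (((ContinuousLinearMap.proj (R := ℝ) (φ := fun _ : Fin 3 => ℂ) j).comp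
      (ContinuousLinearMap.snd ℝ (Fin 3 → ℂ) (Fin 3 → ℂ))).analyticAt _).comp hsσ
  refine ⟨fun z => (s i (σ z)).2 0, fun z => (s i (σ z)).2 1, hsnd 0, hsnd 1, ?_, ?_⟩
  -- A vector of `T^{0,1}` with both coefficients zero is zero, but a frame section does not vanish.
  · rintro ⟨b0, b1⟩
    simp only [hσ0] at b0 b1
    apply h0.1.ne_zero i
    have h1 : projZ (s i 0).2 = 0 := by
      ext j
      fin_cases j
      · exact b0
      · exact b1
    rw [eq_liftT01 h0M hg (by simpa using hρ.differentiableAt) hT0, h1, liftT01_zero]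
  · filter_upwards [hcr, hmem, hσt.eventually (eventually_isGraphNear hg),
      hρ.eventually_analyticAt] with z h1 h2 h3 h4
    by_cases h5 : IsCRPoint M (σ z)
    · have hπ : projZ (σ z) = z := projZ_graphPoint z _
      have h6 := ((mem_T01_iff h5.1 h3 (by rw [hπ]; exact h4.differentiableAt) _).1 (h2 h5)).2.1
      rw [hπ] at h6
      have h7 := conjPart_eq (fderiv ℝ ρ z) (projZ (star (s i (σ z)).2))
      change dbar ρ z _ = _ * dbar ρ z _ + _ * dbar ρ z _ at h7
      rw [h6, projZ_apply] at h7
      simpa using h7.symm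
    -- At a CR singularity both coefficients of `∂̄ρ` vanish, so the relation is trivial.
    · rw [h1] at h5
      push Not at h5
      rw [h5.1, h5.2, mul_zero, mul_zero, add_zero]

/-! ### The contradiction -/

theorem proposition7p4 (M : Set (Fin 3 → ℂ))
    (hM : IsAnalyticSubmanifold M 2) (hconn : IsConnected M)
    (hCRdim : ∀ p, IsCRPoint M p → Module.finrank ℂ (T01 M p) = 1)
    (Q E : (Fin 2 → ℂ) → ℂ) (hQ : IsQuadraticInZZbar Q)
    (hE : AnalyticAt ℝ E 0) (hE3 : E =O[𝓝 0] fun z => ‖z‖ ^ 3)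
    (hform : ∀ᶠ p in 𝓝 (0 : Fin 3 → ℂ),
      (p ∈ M ↔ p 2 = Q ![p 0, p 1] + E ![p 0, p 1]))
    (hsing : (0 : Fin 3 → ℂ) ∈ crSingularSet M)
    (hQ0 : ∃ z v, dbar Q z v ≠ 0)
    (hnp : ¬ CorrespondsToParabolicBishop Q)
    (hdim : varietyDimAt (crSingularSet M) 0 < 2) :
    ¬ IsRemovableCRSingularity M 0 := by
  intro hrem
  obtain ⟨B, S, hS, hdb⟩ := hQ.dbar_eq
  set ρ : (Fin 2 → ℂ) → ℂ := fun z => Q z + E z with hρdef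
  have hρ : AnalyticAt ℝ ρ 0 := (hQ.analyticAt 0).add hE
  have hg : IsGraphNear M ρ 0 := by
    simpa only [IsGraphNear, projZ_apply] using hform
  have hρ0 : ρ 0 = 0 := by simpa using (hg.self_of_nhds.1 hsing.1).symm
  obtain ⟨hf0, hf⟩ : dbar ρ 0 ![1, 0] = 0 ∧
      HasFDerivAt (fun z => dbar ρ z ![1, 0]) (linForm (B 0) (S 0)) 0 :=
    hQ.hasFDerivAt_dbar_add hE hE3 fun z => by simp [hdb]
  obtain ⟨hk0, hk⟩ : dbar ρ 0 ![0, 1] = 0 ∧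
      HasFDerivAt (fun z => dbar ρ z ![0, 1]) (linForm (B 1) (S 1)) 0 :=
    hQ.hasFDerivAt_dbar_add hE hE3 fun z => by simp [hdb]
  have hray : ∀ {F : (Fin 2 → ℂ) → ℂ} {L : (Fin 2 → ℂ) →L[ℝ] ℂ} {z : Fin 2 → ℂ},
      HasFDerivAt F L 0 → L z ≠ 0 → ∀ᶠ t : ℝ in 𝓝[≠] 0, F (t • z) ≠ 0 := by
    intro F L z hF hL
    have h1 : HasDerivAt (fun t : ℝ => t • z) z 0 := by
      simpa using (hasDerivAt_id (0 : ℝ)).smul_const z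
    have h2 : HasFDerivAt F L ((0 : ℝ) • z) := by rwa [zero_smul]
    exact (h2.comp_hasDerivAt 0 h1).eventually_ne hL
  -- A direction where `∂̄Q ≠ 0`: the linear term of `∂̄ρ` dominates along it, so CR points
  -- accumulate at `0`.
  obtain ⟨z₀, hz₀⟩ : ∃ z₀ : Fin 2 → ℂ, ∀ᶠ t : ℝ in 𝓝[≠] 0,
      dbar ρ (t • z₀) ![1, 0] ≠ 0 ∨ dbar ρ (t • z₀) ![0, 1] ≠ 0 := by
    obtain ⟨z, v, hzv⟩ := hQ0
    refine ⟨z, ?_⟩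
    by_cases h : linForm (B 0) (S 0) z = 0
    · have h' : linForm (B 1) (S 1) z ≠ 0 := by
        intro h'
        apply hzv
        rw [hdb, h, h', mul_zero, mul_zero, add_zero]
      exact (hray hk h').mono fun t => Or.inr
    · exact (hray hf h).mono fun t => Or.inl
  obtain ⟨b, c, hb, hc, hbc, hrel⟩ :=
    exists_relation_of_isRemovable hCRdim hg hρ hρ0 hz₀ hrem
  -- Since `∂̄ρ` vanishes at `0`, the product rule leaves only the values `b 0` and `c 0`.
  have hrel0 : ∀ z, b 0 * linForm (B 0) (S 0) z + c 0 * linForm (B 1) (S 1) z = 0 := by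
    have h1 := (hb.differentiableAt.hasFDerivAt.mul hf).add
      (hc.differentiableAt.hasFDerivAt.mul hk)
    have h2 := h1.unique ((hasFDerivAt_const (0 : ℂ) (0 : Fin 2 → ℂ)).congr_of_eventuallyEq hrel)
    intro z
    simpa [hf0, hk0] using congrArg (fun L : (Fin 2 → ℂ) →L[ℝ] ℂ => L z) h2
  have hsurj := surjective_linForm_of_relation hS hdb hQ0 hnp (b := ![b 0, c 0])
    (fun h => hbc ⟨congrFun h 0, congrFun h 1⟩) hrel0
  simp only [Matrix.cons_val_zero, Matrix.cons_val_one] at hsurj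
  set G : (Fin 2 → ℂ) → ℂ := fun z =>
    star (c 0) * dbar ρ z ![1, 0] - star (b 0) * dbar ρ z ![0, 1] with hG
  have hGa : AnalyticAt ℝ G 0 := (analyticAt_const.mul (analyticAt_dbar hρ _)).sub
    (analyticAt_const.mul (analyticAt_dbar hρ _))
  have hGd : ∀ z, fderiv ℝ G 0 z =
      star (c 0) * linForm (B 0) (S 0) z - star (b 0) * linForm (B 1) (S 1) z := by
    intro z
    have h : HasFDerivAt G _ 0 := (hf.const_mul (star (c 0))).sub (hk.const_mul (star (b 0)))
    rw [h.fderiv]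
    simp
  -- The relation and `G = 0` form a linear system for the coefficients of `∂̄ρ`; up to sign its
  -- determinant is `b(z)b̄(0) + c(z)c̄(0)`, nonzero near `0`.
  have hGz : ∀ᶠ z in 𝓝 0, (G z = 0 ↔ dbar ρ z ![1, 0] = 0 ∧ dbar ρ z ![0, 1] = 0) := by
    have hN : b 0 * star (b 0) + c 0 * star (c 0) ≠ 0 := by
      intro h
      rw [Complex.star_def, Complex.mul_conj, Complex.mul_conj] at h
      have h1 : Complex.normSq (b 0) + Complex.normSq (c 0) = 0 := by exact_mod_cast h
      have n0 := Complex.normSq_nonneg (b 0)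
      have n1 := Complex.normSq_nonneg (c 0)
      exact hbc ⟨Complex.normSq_eq_zero.1 (by linarith), Complex.normSq_eq_zero.1 (by linarith)⟩
    have hcont : ContinuousAt (fun z => b z * star (b 0) + c z * star (c 0)) 0 :=
      (hb.continuousAt.mul continuousAt_const).add (hc.continuousAt.mul continuousAt_const)
    filter_upwards [hrel, hcont.eventually_ne hN] with z h1 h2
    constructor
    · intro h3
      simp only [hG] at h3
      constructor
      · refine (mul_eq_zero.1 ?_).resolve_left h2
        linear_combination star (b 0) * h1 + c z * h3
      · refine (mul_eq_zero.1 ?_).resolve_left h2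
        linear_combination star (c 0) * h1 - b z * h3
    · rintro ⟨h3, h4⟩
      simp only [hG, h3, h4, mul_zero, sub_zero]
  refine absurd hdim (not_lt.2 (two_le_varietyDimAt ?_))
  have hπ0 : projZ 0 = 0 := map_zero _
  have hGπ : AnalyticAt ℝ (fun p => G (projZ p)) 0 :=
    AnalyticAt.comp (g := G) (by rwa [hπ0]) (projZ.analyticAt 0)
  have hρπ : AnalyticAt ℝ (fun p => ρ (projZ p)) 0 :=
    AnalyticAt.comp (g := ρ) (by rwa [hπ0]) (projZ.analyticAt 0)
  have hpr : AnalyticAt ℝ (fun p : Fin 3 → ℂ => p 2) 0 :=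
    (ContinuousLinearMap.proj (R := ℝ) (φ := fun _ : Fin 3 => ℂ) 2).analyticAt 0
  refine isAnalyticSubmanifoldAt_four hsing (hpr.sub hρπ) hGπ ?_ ?_
  · intro y y'
    obtain ⟨z, hz⟩ := hsurj y'
    -- `G` does not involve `w`, so `z` is chosen for the second equation and `w` then corrects the
    -- first.
    refine ⟨graphPoint z (y + fderiv ℝ ρ 0 z), ?_, ?_⟩
    · have h1 : HasFDerivAt ρ (fderiv ℝ ρ 0) (projZ 0) := by
        rw [hπ0]
        exact hρ.differentiableAt.hasFDerivAt
      have h2 : HasFDerivAt (fun p : Fin 3 → ℂ => p 2 - ρ (projZ p)) _ 0 :=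
        (ContinuousLinearMap.proj (R := ℝ) (φ := fun _ : Fin 3 => ℂ) 2).hasFDerivAt.sub
          (h1.comp 0 projZ.hasFDerivAt)
      change fderiv ℝ (fun p : Fin 3 → ℂ => p 2 - ρ (projZ p)) 0 _ = y
      rw [h2.fderiv]
      simp [projZ_graphPoint]
    · have h1 : HasFDerivAt G (fderiv ℝ G 0) (projZ 0) := by
        rw [hπ0]
        exact hGa.differentiableAt.hasFDerivAt
      have h2 : HasFDerivAt (fun p : Fin 3 → ℂ => G (projZ p)) _ 0 :=
        h1.comp 0 projZ.hasFDerivAt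
      rw [h2.fderiv, ContinuousLinearMap.comp_apply, projZ_graphPoint, hGd, hz]
  · filter_upwards [hg, eventually_isCRPoint_iff hg hρ hCRdim,
      tendsto_projZ_zero.eventually hGz] with p h1 h2 h3
    rw [h3]
    change p ∈ M ∧ ¬ IsCRPoint M p ↔ p 2 - ρ (projZ p) = 0 ∧ _
    rw [sub_eq_zero, ← h1]
    refine and_congr_right fun hp => ?_
    rw [h2 hp]
    push Not
    rfl
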